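/- **Setting.** All graphs are finite, simple and undirected. A graph $G$ has arboricity at most $c$ if its edge set can be partitioned into at most $c$ forests. $M^*(G)$ denotes the size (number of edges) of a maximum matching of $G$. An (adversarial-order) insertion-only stream of the edges of $G$ is a list, in arbitrary order, in which every edge of $G$ occurs exactly once and nothing else occurs. A randomized one-pass streaming algorithm with space of $s$ words of $w$ bits has as its only memory $s$ words of $w$ bits; it starts with a (possibly random) memory content, replaces the memory content, upon the arrival of each edge, by a random new content whose law depends only on the current content and on that edge (with fresh randomness in each step), and after the last edge outputs a real number determined by the final memory content. A number $x$ is a $\lambda$-approximation of $M^*$ if $M^*\le x\le \lambda M^*$. **Theorem.** For every $A>0$ there is a constant $K>0$ such that the following holds for all integers $n\ge 2$, $c\ge 1$ and all reals $0<\varepsilon<1$ and $n^{-A}\le\delta<1$ (in particular, for any fixed $\delta\in(0,1)$, for all $n \ge 2$, once $A$ is chosen so that $2^{-A}\le\delta$). There is a randomized one-pass streaming algorithm that uses at most $$K\cdot\frac{c}{\varepsilon^2}\,\log\frac{2}{\varepsilon}\,\log(cn)\,\log n$$ words of at most $K\log n$ bits each, such that for every graph $G$ on the vertex set $\{0,\dots,n-1\}$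 of arboricity at most $c$ and every insertion-only stream $S$ of the edges of $G$, the algorithm run on $S$ outputs, with probability at least $1-\delta$, a $(22.5c+6)(1+\varepsilon)$-approximation of $M^*(G)$. -/

import Mathlib

/-- The edges of `G` can be partitioned into at most `c` forests, i.e. `G` has arboricity at most
`c` (some of the `c` forests may have no edges). -/
def SimpleGraph.HasArboricityAtMost {V : Type*} (G : SimpleGraph V) (c : ℕ) : Prop :=
  ∃ F : Fin c → SimpleGraph V,
    (∀ i, (F i).IsAcyclic) ∧
    (∀ i j, i ≠ j → Disjoint (F i).edgeSet (F j).edgeSet) ∧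
    (⋃ i, (F i).edgeSet) = G.edgeSet

/-- The size (number of edges) of a maximum matching of `G`. -/
noncomputable def SimpleGraph.maxMatchingSize {V : Type*} (G : SimpleGraph V) : ℕ :=
  sSup {k : ℕ | ∃ M : G.Subgraph, M.IsMatching ∧ M.edgeSet.ncard = k}

/-- On a finite vertex set the supremum above is attained, so it is a maximum. -/
theorem SimpleGraph.isGreatest_maxMatchingSize {V : Type*} [Finite V] (G : SimpleGraph V) :
    IsGreatest {k : ℕ | ∃ M : G.Subgraph, M.IsMatching ∧ M.edgeSet.ncard = k}
      G.maxMatchingSize := by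
  have hne : {k : ℕ | ∃ M : G.Subgraph, M.IsMatching ∧ M.edgeSet.ncard = k}.Nonempty :=
    ⟨_, ⊥, fun v hv => by simp at hv, rfl⟩
  have hbdd : BddAbove {k : ℕ | ∃ M : G.Subgraph, M.IsMatching ∧ M.edgeSet.ncard = k} := by
    refine ⟨G.edgeSet.ncard, ?_⟩
    rintro _ ⟨M, -, rfl⟩
    exact Set.ncard_le_ncard M.edgeSet_subset (Set.toFinite _)
  exact ⟨Nat.sSup_mem hne hbdd, fun k hk => le_csSup hbdd hk⟩

/-- `S` is an insertion-only stream of the edges of `G`: a list in which every edge of `G` occurs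
exactly once, in an arbitrary order, and nothing else occurs. -/
def SimpleGraph.IsEdgeStream {V : Type*} (G : SimpleGraph V) (S : List (Sym2 V)) : Prop :=
  S.Nodup ∧ ∀ e, e ∈ S ↔ e ∈ G.edgeSet

/-- Contents of a memory of `s` words of `w` bits each. -/
abbrev WordMemory (s w : ℕ) : Type := Fin s → BitVec w

/-- A randomized streaming algorithm for streams of items from `α` whose whole memory consists of
`s` words of `w` bits. The memory is initialized at random; each arriving item updates the memory
by a random rule that sees only the current memory and that item (fresh randomness in every step;
random bits that are to be used again have to be kept in the memory); the output is a function of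
the final memory. -/
structure StreamingAlgorithm (α : Type) (s w : ℕ) where
  init : PMF (WordMemory s w)
  update : WordMemory s w → α → PMF (WordMemory s w)
  output : WordMemory s w → ℝ

namespace StreamingAlgorithm

/-- The law of the memory after reading the given list of items from left to right, starting with
the given memory. -/
noncomputable def runFrom {α : Type} {s w : ℕ} (A : StreamingAlgorithm α s w) :
    WordMemory s w → List α → PMF (WordMemory s w)
  | σ, [] => PMF.pure σ
  | σ, a :: S => (A.update σ a).bind fun σ' => A.runFrom σ' S

/-- The law of the output after one pass over the stream `S`. -/
noncomputable def outputLaw {α : Type} {s w : ℕ} (A : StreamingAlgorithm α s w)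
    (S : List α) : PMF ℝ :=
  (A.init.bind fun σ => A.runFrom σ S).map A.output

end StreamingAlgorithm

/-- `x` is a `lam`-approximation of the (maximization) value `M`: it never underestimates `M` and
overestimates it at most by the factor `lam`. -/
def IsApproximation (lam : ℝ) (M x : ℝ) : Prop :=
  M ≤ x ∧ x ≤ lam * M

section

open scoped Classical

/-! Call a stream edge good if at most `2c` later edges meet it, and let `m` be the number of good
edges. Then `M* ≤ m ≤ (2c+1) M*`.

Upper bound: scan the good edges in stream order, keep an edge and discard the at most `2c` later
good ones that meet it; what is kept is a matching (`goodEdges_length_le`).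

Lower bound: let `H` be the set of vertices of degree greater than `c`. A matching has at most `|H|`
edges touching `H`, so `M* ≤ |H| + out`, with `out` the number of edges avoiding `H`. Each vertex of
`H` has `c+1` last incidences, and an edge that is late at both endpoints is good. Counting edge by
edge gives `(c+1)|H| + out ≤ in + m`, where the edges inside `H` number `in ≤ c|H|` by arboricity;
hence `|H| + out ≤ m` (`maxMatchingSize_le_goodEdges`).

It remains to estimate `m` in small space. Level `i` samples edges at rate `2⁻ⁱ`, keeps a counter of
later meeting edges with each sample, drops a sample once its counter passes `2c`, and is abandoned
for good if it ever holds more than `T` samples. The output is `3 · 2ⁱ` times the size of the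
densest surviving level. Chernoff bounds and a union bound (`toOuterMeasure_not_accurate_le`) put it
between `m` and `9m`, hence between `M*` and `9(2c+1) M*`, and `9(2c+1) ≤ 22.5c+6`. A
constant-factor estimate of `m` thus suffices, and the dependence of the bounds on `ε` is slack. -/

theorem SimpleGraph.IsAcyclic.ncard_edgeSet_le {V : Type*} [Finite V] {F : SimpleGraph V}
    (hF : F.IsAcyclic) : F.edgeSet.ncard ≤ Nat.card V := by
  cases isEmpty_or_nonempty V with
  | inl h =>
    have : F.edgeSet = ∅ := by
      ext e
      induction e with | _ u v => exact h.elim u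
    simp [this]
  | inr h =>
    have := Fintype.ofFinite V
    obtain ⟨T, hFT, -, hT⟩ :=
      (SimpleGraph.connected_top (V := V)).exists_isTree_le_of_le_of_isAcyclic le_top hF
    have h1 : F.edgeSet.ncard ≤ T.edgeSet.ncard :=
      Set.ncard_le_ncard (SimpleGraph.edgeSet_mono hFT) (Set.toFinite _)
    have h2 := hT.card_edgeFinset
    rw [← SimpleGraph.coe_edgeFinset T, Set.ncard_coe_finset] at h1
    rw [Nat.card_eq_fintype_card]
    omega

theorem SimpleGraph.IsAcyclic.ncard_edges_inside_le {V : Type*} {F : SimpleGraph V}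
    (hF : F.IsAcyclic) (H : Finset V) :
    {e ∈ F.edgeSet | ∀ v ∈ e, v ∈ H}.ncard ≤ H.card := by
  have h1 : {e ∈ F.edgeSet | ∀ v ∈ e, v ∈ H} ⊆
      Sym2.map Subtype.val '' (F.induce (H : Set V)).edgeSet := by
    rintro e ⟨he, hH⟩
    induction e with
    | _ u v =>
      refine ⟨s(⟨u, hH u (by simp)⟩, ⟨v, hH v (by simp)⟩), ?_, by simp⟩
      simpa using he
  have h2 := (hF.induce (H : Set V)).ncard_edgeSet_le
  calc _ ≤ _ := Set.ncard_le_ncard h1 (Set.toFinite _)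
    _ ≤ _ := Set.ncard_image_le (Set.toFinite _)
    _ ≤ _ := h2
    _ = _ := by simp

theorem SimpleGraph.HasArboricityAtMost.ncard_edges_inside_le {V : Type*} [Finite V]
    {G : SimpleGraph V} {c : ℕ} (hG : G.HasArboricityAtMost c) (H : Finset V) :
    {e ∈ G.edgeSet | ∀ v ∈ e, v ∈ H}.ncard ≤ c * H.card := by
  obtain ⟨F, hF, -, hU⟩ := hG
  have h1 : {e ∈ G.edgeSet | ∀ v ∈ e, v ∈ H} =
      ⋃ i, {e ∈ (F i).edgeSet | ∀ v ∈ e, v ∈ H} := by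
    ext e
    simp [← hU]
  rw [h1]
  calc _ ≤ ∑ i : Fin c, {e ∈ (F i).edgeSet | ∀ v ∈ e, v ∈ H}.ncard := by
        have := Set.ncard_iUnion_le_of_fintype fun i => {e ∈ (F i).edgeSet | ∀ v ∈ e, v ∈ H}
        simpa using this
    _ ≤ ∑ i : Fin c, H.card := Finset.sum_le_sum fun i _ => (hF i).ncard_edges_inside_le H
    _ = _ := by simp

namespace MatchingStream

/-- Two edges meet if they share an endpoint. -/
def Meets {V : Type*} (e f : Sym2 V) : Prop := ∃ v, v ∈ e ∧ v ∈ f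

/-- The number of entries of `S` that contain the vertex `v`. -/
noncomputable def degreeIn {V : Type*} (v : V) (S : List (Sym2 V)) : ℕ :=
  S.countP fun f => v ∈ f

/-- The number of entries of `S` that meet `e`. -/
noncomputable def meetCount {V : Type*} (e : Sym2 V) (S : List (Sym2 V)) : ℕ :=
  S.countP fun f => Meets e f

/-- The entries of `S` that meet at most `b` later entries. -/
noncomputable def goodEdges {V : Type*} (b : ℕ) : List (Sym2 V) → List (Sym2 V)
  | [] => []
  | e :: S => if meetCount e S ≤ b then e :: goodEdges b S else goodEdges b S

/-! ### Good edges versus maximum matchings. -/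

section Structure

variable {V : Type*}

theorem degreeIn_cons (v : V) (e : Sym2 V) (S : List (Sym2 V)) :
    degreeIn v (e :: S) = degreeIn v S + if v ∈ e then 1 else 0 := by
  simp [degreeIn, List.countP_cons]

theorem meetCount_cons (e f : Sym2 V) (S : List (Sym2 V)) :
    meetCount e (f :: S) = meetCount e S + if Meets e f then 1 else 0 := by
  simp [meetCount, List.countP_cons]

theorem meetCount_le_add_degreeIn (u v : V) (S : List (Sym2 V)) :
    meetCount s(u, v) S ≤ degreeIn u S + degreeIn v S := by
  induction S with
  | nil => simp [meetCount]
  | cons f S ih =>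
    rw [meetCount_cons, degreeIn_cons, degreeIn_cons]
    by_cases h : Meets s(u, v) f
    · obtain ⟨w, hw, hf⟩ := h
      rcases Sym2.mem_iff.1 hw with rfl | rfl <;> simp only [hf] <;> split_ifs <;> omega
    · rw [if_neg h]; split_ifs <;> omega

theorem goodEdges_sublist (b : ℕ) (S : List (Sym2 V)) : (goodEdges b S).Sublist S := by
  induction S with
  | nil => simp [goodEdges]
  | cons e S ih =>
    rw [goodEdges]
    split_ifs
    · exact ih.cons_cons e
    · exact ih.cons e

/-- The number of entries of `S` that contain `v` and are followed by at most `c` entries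
containing `v`. -/
noncomputable def lateIncidences (c : ℕ) (v : V) : List (Sym2 V) → ℕ
  | [] => 0
  | e :: S => lateIncidences c v S + if v ∈ e ∧ degreeIn v S ≤ c then 1 else 0

theorem lateIncidences_eq (c : ℕ) (v : V) (S : List (Sym2 V)) :
    lateIncidences c v S = min (degreeIn v S) (c + 1) := by
  induction S with
  | nil => simp [lateIncidences, degreeIn]
  | cons e S ih =>
    rw [lateIncidences, degreeIn_cons, ih]
    by_cases h : v ∈ e <;> by_cases h' : degreeIn v S ≤ c <;> simp [h, h'] <;> omega

/-- Contribution of a single edge. Endpoints outside `H` are automatically late, so an edge that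
avoids `H`, or is late at its only endpoint in `H`, is good. An edge inside `H` is paid for once by
the first term on the right, and a second time by being good if it is late at both ends. -/
theorem sum_late_le_aux {c : ℕ} {H : Finset V} {S : List (Sym2 V)} {u v : V} (huv : u ≠ v)
    (hu : u ∉ H → degreeIn u S ≤ c) (hv : v ∉ H → degreeIn v S ≤ c) :
    (∑ x ∈ H, if x ∈ s(u, v) ∧ degreeIn x S ≤ c then 1 else 0) +
        (if ∀ x ∈ s(u, v), x ∉ H then 1 else 0) ≤
      (if ∀ x ∈ s(u, v), x ∈ H then 1 else 0) +
        if meetCount s(u, v) S ≤ 2 * c then 1 else 0 := by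
  have h1 : (∑ x ∈ H, if x ∈ s(u, v) ∧ degreeIn x S ≤ c then 1 else 0) ≤
      (if u ∈ H ∧ degreeIn u S ≤ c then 1 else 0) +
        if v ∈ H ∧ degreeIn v S ≤ c then 1 else 0 := by
    rw [← Finset.card_filter]
    have hsub : H.filter (fun x => x ∈ s(u, v) ∧ degreeIn x S ≤ c) ⊆
        (if u ∈ H ∧ degreeIn u S ≤ c then {u} else ∅) ∪
          (if v ∈ H ∧ degreeIn v S ≤ c then {v} else ∅) := by
      intro x hx
      simp only [Finset.mem_filter, Sym2.mem_iff] at hx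
      obtain ⟨hxH, rfl | rfl, hd⟩ := hx <;> simp [hxH, hd]
    refine (Finset.card_le_card hsub).trans ((Finset.card_union_le _ _).trans ?_)
    gcongr <;> split_ifs <;> simp
  have h2 := meetCount_le_add_degreeIn u v S
  refine (Nat.add_le_add_right h1 _).trans ?_
  simp only [Sym2.mem_iff, forall_eq_or_imp, forall_eq]
  by_cases a1 : u ∈ H <;> by_cases a2 : v ∈ H <;> by_cases a3 : degreeIn u S ≤ c <;>
    by_cases a4 : degreeIn v S ≤ c <;> simp_all <;> first | omega | (split_ifs <;> omega)

theorem sum_late_le {c : ℕ} {H : Finset V} {S : List (Sym2 V)} (hdiag : ∀ e ∈ S, ¬ e.IsDiag)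
    (hlight : ∀ v ∉ H, degreeIn v S ≤ c) :
    (∑ v ∈ H, lateIncidences c v S) + S.countP (fun e => ∀ v ∈ e, v ∉ H) ≤
      S.countP (fun e => ∀ v ∈ e, v ∈ H) + (goodEdges (2 * c) S).length := by
  induction S with
  | nil => simp [lateIncidences, goodEdges]
  | cons e S ih =>
    have hl : ∀ v ∉ H, degreeIn v S ≤ c := fun v hv => by
      have := hlight v hv
      rw [degreeIn_cons] at this
      omega
    have ih := ih (fun f hf => hdiag f (by simp [hf])) hl
    have hd := hdiag e (by simp)
    induction e with
    | _ u v =>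
      have key := sum_late_le_aux (H := H) (S := S) (c := c) (u := u) (v := v)
        (by simpa using hd) (hl u) (hl v)
      have hg : (goodEdges (2 * c) (s(u, v) :: S)).length = (goodEdges (2 * c) S).length +
          if meetCount s(u, v) S ≤ 2 * c then 1 else 0 := by
        rw [goodEdges]
        split_ifs <;> simp
      rw [hg]
      simp only [lateIncidences, Finset.sum_add_distrib, List.countP_cons, decide_eq_true_eq]
      omega

theorem countP_inside_le [Finite V] {G : SimpleGraph V} {c : ℕ} (hG : G.HasArboricityAtMost c)
    {S : List (Sym2 V)} (hS : G.IsEdgeStream S) (H : Finset V) :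
    S.countP (fun e => ∀ v ∈ e, v ∈ H) ≤ c * H.card := by
  refine le_trans ?_ (hG.ncard_edges_inside_le H)
  rw [List.countP_eq_length_filter, ← List.toFinset_card_of_nodup (hS.1.filter _),
    ← Set.ncard_coe_finset]
  refine Set.ncard_le_ncard (fun e he => ?_) (Set.toFinite _)
  have : e ∈ S ∧ ∀ v ∈ e, v ∈ H := by simpa using he
  exact ⟨(hS.2 e).1 this.1, this.2⟩

/-- Matching edges touching `H` inject into `H` by choosing an endpoint there. -/
theorem matching_le_card_add_countP [Finite V] {G : SimpleGraph V} {S : List (Sym2 V)}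
    (hS : G.IsEdgeStream S) (H : Finset V) {M : G.Subgraph} (hM : M.IsMatching) :
    M.edgeSet.ncard ≤ H.card + S.countP (fun e => ∀ v ∈ e, v ∉ H) := by
  have h1 : M.edgeSet ⊆ {e ∈ M.edgeSet | ∃ v ∈ e, v ∈ H} ∪
      ((S.filter (fun e => ∀ v ∈ e, v ∉ H)).toFinset : Set (Sym2 V)) := by
    intro e he
    by_cases h : ∃ v ∈ e, v ∈ H
    · exact Or.inl ⟨he, h⟩
    · right
      push Not at h
      simpa using ⟨(hS.2 e).2 (M.edgeSet_subset he), h⟩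
  have h2 : {e ∈ M.edgeSet | ∃ v ∈ e, v ∈ H}.ncard ≤ H.card := by
    rw [← Set.ncard_coe_finset H]
    refine Set.ncard_le_ncard_of_injOn
      (fun e => if h : ∃ v ∈ e, v ∈ H then h.choose else e.out.1) ?_ ?_ (Set.toFinite _)
    · rintro e ⟨-, h⟩
      rw [dif_pos h]
      exact h.choose_spec.2
    · rintro e ⟨he, h⟩ f ⟨hf, h'⟩ hef
      simp only [h, h', dif_pos] at hef
      have a1 := h.choose_spec.1
      have a2 := h'.choose_spec.1
      rw [← hef] at a2
      generalize h.choose = x at a1 a2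
      obtain ⟨y, rfl⟩ := a1
      obtain ⟨z, rfl⟩ := a2
      rw [SimpleGraph.Subgraph.mem_edgeSet] at he hf
      rw [(hM (M.edge_vert he)).unique he hf]
  calc _ ≤ _ := Set.ncard_le_ncard h1 (Set.toFinite _)
    _ ≤ _ := Set.ncard_union_le _ _
    _ ≤ _ := by
      gcongr
      rw [Set.ncard_coe_finset, List.countP_eq_length_filter]
      exact List.toFinset_card_le _

theorem maxMatchingSize_le_goodEdges [Finite V] {G : SimpleGraph V} {c : ℕ}
    (hG : G.HasArboricityAtMost c) {S : List (Sym2 V)} (hS : G.IsEdgeStream S) :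
    G.maxMatchingSize ≤ (goodEdges (2 * c) S).length := by
  have := Fintype.ofFinite V
  obtain ⟨M, hM, hcard⟩ := G.isGreatest_maxMatchingSize.1
  let H : Finset V := Finset.univ.filter fun v => c < degreeIn v S
  have h1 := matching_le_card_add_countP hS H hM
  have h2 := countP_inside_le hG hS H
  have h3 := sum_late_le (c := c) (H := H) (S := S)
    (fun e he => G.not_isDiag_of_mem_edgeSet ((hS.2 e).1 he))
    (fun v hv => by simpa [H] using hv)
  have h4 : ∑ v ∈ H, lateIncidences c v S = H.card * (c + 1) := by
    rw [Finset.sum_const_nat]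
    intro v hv
    rw [lateIncidences_eq, min_eq_right]
    simpa [H] using hv
  -- Now `|H|(c+1) + out ≤ in + good` and `in ≤ c|H|`, which leaves `|H| + out ≤ good`.
  rw [h4] at h3
  rw [← hcard]
  nlinarith

/-- Every entry of the list meets at most `b` later entries. -/
def LaterMeetsAtMost (b : ℕ) : List (Sym2 V) → Prop
  | [] => True
  | e :: S => meetCount e S ≤ b ∧ LaterMeetsAtMost b S

theorem LaterMeetsAtMost.sublist {b : ℕ} {S T : List (Sym2 V)} (hS : LaterMeetsAtMost b S)
    (h : T.Sublist S) : LaterMeetsAtMost b T := by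
  induction h with
  | slnil => exact hS
  | cons e _ ih => exact ih hS.2
  | cons_cons e h ih => exact ⟨(h.countP_le).trans hS.1, ih hS.2⟩

theorem laterMeetsAtMost_goodEdges (b : ℕ) (S : List (Sym2 V)) :
    LaterMeetsAtMost b (goodEdges b S) := by
  induction S with
  | nil => trivial
  | cons e S ih =>
    rw [goodEdges]
    split_ifs with h
    · exact ⟨((goodEdges_sublist b S).countP_le).trans h, ih⟩
    · exact ih

/-- Greedy selection: keeping the head costs at most `b + 1` entries, itself and the later ones
meeting it. -/
theorem LaterMeetsAtMost.exists_pairwise {b : ℕ} (n : ℕ) : ∀ {S : List (Sym2 V)},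
    S.length ≤ n → LaterMeetsAtMost b S → ∃ m : List (Sym2 V), m.Sublist S ∧
      m.Pairwise (fun e f => ¬ Meets e f) ∧ S.length ≤ (b + 1) * m.length := by
  induction n with
  | zero => exact fun {S} hn _ => ⟨[], by simp, by simp, by simpa using hn⟩
  | succ n ih =>
    rintro (_ | ⟨e, S⟩) hn hS
    · exact ⟨[], by simp, by simp, by simp⟩
    · have hsub : (S.filter fun f => ¬ Meets e f).Sublist S := List.filter_sublist
      obtain ⟨m, hm, hpw, hlen⟩ := ih (S := S.filter fun f => ¬ Meets e f)
        (hsub.length_le.trans (by simpa using hn)) (hS.2.sublist hsub)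
      refine ⟨e :: m, (hm.trans hsub).cons_cons e, List.pairwise_cons.2 ⟨fun f hf => ?_, hpw⟩, ?_⟩
      · simpa using (List.mem_filter.1 (hm.subset hf)).2
      · have h1 := hS.1
        have h2 := S.length_eq_countP_add_countP (fun f => Meets e f)
        rw [← List.countP_eq_length_filter] at hlen
        simp only [meetCount, List.length_cons, decide_eq_true_eq] at *
        have : S.countP (fun a => decide ¬ (Meets e a)) ≤ (b + 1) * m.length := hlen
        nlinarith

theorem length_le_maxMatchingSize [Finite V] {G : SimpleGraph V} {m : List (Sym2 V)}
    (hm : ∀ e ∈ m, e ∈ G.edgeSet) (hnd : m.Nodup) (hpw : m.Pairwise fun e f => ¬ Meets e f) :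
    m.length ≤ G.maxMatchingSize := by
  let M : G.Subgraph :=
    { verts := {v | ∃ e ∈ m, v ∈ e}
      Adj := fun u v => s(u, v) ∈ m
      adj_sub := fun h => hm _ h
      edge_vert := fun h => ⟨_, h, by simp⟩
      symm := ⟨fun u v h => by rwa [Sym2.eq_swap]⟩ }
  refine G.isGreatest_maxMatchingSize.2 ⟨M, ?_, ?_⟩
  · rintro v ⟨e, he, w, rfl⟩
    refine ⟨w, he, fun x hx => ?_⟩
    by_contra hne
    have hne' : s(v, x) ≠ s(v, w) := fun h => hne (Sym2.congr_right.1 h)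
    have hsymm : Std.Symm fun e f : Sym2 V => ¬ Meets e f :=
      ⟨fun e f h ⟨y, h1, h2⟩ => h ⟨y, h2, h1⟩⟩
    exact hpw.forall hx he hne' ⟨v, by simp, by simp⟩
  · have : M.edgeSet = (m.toFinset : Set (Sym2 V)) := by
      ext e
      induction e with
      | _ u v =>
        rw [SimpleGraph.Subgraph.mem_edgeSet]
        simp [M]
    rw [this, Set.ncard_coe_finset, List.toFinset_card_of_nodup hnd]

theorem goodEdges_length_le [Finite V] {G : SimpleGraph V} {S : List (Sym2 V)}
    (hS : ∀ e ∈ S, e ∈ G.edgeSet) (hnd : S.Nodup) (b : ℕ) :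
    (goodEdges b S).length ≤ (b + 1) * G.maxMatchingSize := by
  obtain ⟨m, hm, hpw, hlen⟩ := (laterMeetsAtMost_goodEdges b S).exists_pairwise _ le_rfl
  have hsub := hm.trans (goodEdges_sublist b S)
  exact hlen.trans (Nat.mul_le_mul_left _ (length_le_maxMatchingSize
    (fun e he => hS e (hsub.subset he)) (hnd.sublist hsub) hpw))

end Structure

/-! ### Expectations under discrete laws, and Markov's inequality. -/

section Expectation

variable {α β : Type*}

/-- The expectation of a nonnegative function under a discrete law. -/
noncomputable def expect (q : PMF α) (f : α → ENNReal) : ENNReal := ∑' a, q a * f a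

theorem expect_bind (p : PMF α) (q : α → PMF β) (f : β → ENNReal) :
    expect (p.bind q) f = expect p fun a => expect (q a) f := by
  simp only [expect, PMF.bind_apply, ← ENNReal.tsum_mul_right, ← ENNReal.tsum_mul_left]
  rw [ENNReal.tsum_comm]
  simp only [mul_assoc]

theorem expect_pure (a : α) (f : α → ENNReal) : expect (PMF.pure a) f = f a := by
  rw [expect, tsum_eq_single a]
  · simp
  · intro b hb
    simp [PMF.pure_apply_of_ne _ _ hb]

theorem expect_map (p : PMF α) (g : α → β) (f : β → ENNReal) :
    expect (p.map g) f = expect p fun a => f (g a) := by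
  rw [← PMF.bind_pure_comp, expect_bind]
  simp only [Function.comp_apply, expect_pure]

theorem expect_congr {p : PMF α} {f g : α → ENNReal} (h : ∀ a ∈ p.support, f a = g a) :
    expect p f = expect p g := by
  refine tsum_congr fun a => ?_
  by_cases ha : p a = 0
  · simp [ha]
  · rw [h a ha]

theorem expect_const_mul (p : PMF α) (c : ENNReal) (f : α → ENNReal) :
    expect p (fun a => c * f a) = c * expect p f := by
  simp only [expect, ← ENNReal.tsum_mul_left]
  exact tsum_congr fun a => by ring

theorem expect_mul_const (p : PMF α) (c : ENNReal) (f : α → ENNReal) :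
    expect p (fun a => f a * c) = expect p f * c := by
  simp only [expect, ← ENNReal.tsum_mul_right, mul_assoc]

theorem expect_const (p : PMF α) (c : ENNReal) : expect p (fun _ => c) = c := by
  rw [expect, ENNReal.tsum_mul_right, p.tsum_coe, one_mul]

theorem expect_ite (p : PMF α) (s : α → Prop) (x y : ENNReal) :
    expect p (fun a => if s a then x else y) =
      p.toOuterMeasure {a | s a} * x + p.toOuterMeasure {a | ¬ s a} * y := by
  simp only [expect, PMF.toOuterMeasure_apply, ← ENNReal.tsum_mul_right, ← ENNReal.tsum_add]
  refine tsum_congr fun a => ?_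
  by_cases h : s a <;> simp [h]

theorem toOuterMeasure_add_not (p : PMF α) (s : α → Prop) :
    p.toOuterMeasure {a | s a} + p.toOuterMeasure {a | ¬ s a} = 1 := by
  have := expect_ite p s 1 1
  simpa [expect_const] using this.symm

theorem mul_toOuterMeasure_le_expect (p : PMF α) (f : α → ENNReal) (x : ENNReal) :
    p.toOuterMeasure {a | x ≤ f a} * x ≤ expect p f := by
  rw [PMF.toOuterMeasure_apply, ← ENNReal.tsum_mul_right]
  refine ENNReal.tsum_le_tsum fun a => ?_
  by_cases h : x ≤ f a
  · simpa [h] using mul_le_mul_right h (p a)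
  · simp [h]

end Expectation

/-! ### Exponential moments and tails of the number of sampled good edges. -/

section Sampling

variable {α B : Type}

/-- The law of the stream `S` with an independent seed of law `ρ` attached to every entry. -/
noncomputable def seededLaw (ρ : PMF B) : List α → PMF (List (α × B))
  | [] => PMF.pure []
  | a :: S => ρ.bind fun g => (seededLaw ρ S).map fun Z => (a, g) :: Z

theorem map_fst_of_mem_support (ρ : PMF B) (S : List α) :
    ∀ Z ∈ (seededLaw ρ S).support, Z.map Prod.fst = S := by
  induction S with
  | nil => simp [seededLaw]
  | cons a S ih =>
    intro Z hZ
    simp only [seededLaw, PMF.mem_support_bind_iff, PMF.mem_support_map_iff] at hZ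
    obtain ⟨g, -, Z', hZ', rfl⟩ := hZ
    simp [ih Z' hZ']

variable {V : Type}

/-- The number of entries that meet at most `b` later entries and whose seed is selected. -/
noncomputable def sampledCount (b : ℕ) (sel : B → Prop) : List (Sym2 V × B) → ℕ
  | [] => 0
  | x :: Z => sampledCount b sel Z +
      if sel x.2 ∧ meetCount x.1 (Z.map Prod.fst) ≤ b then 1 else 0

/-- Generating function of a binomial variable: goodness depends only on the stream, and each good
edge is selected independently. -/
theorem expect_pow_sampledCount (ρ : PMF B) (b : ℕ) (sel : B → Prop) (x : ENNReal)
    (S : List (Sym2 V)) (t : ℕ) :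
    expect (seededLaw ρ S) (fun Z => x ^ sampledCount b sel (Z.take t)) =
      (ρ.toOuterMeasure {g | sel g} * x + ρ.toOuterMeasure {g | ¬ sel g}) ^
        (goodEdges b (S.take t)).length := by
  induction S generalizing t with
  | nil => simp [seededLaw, expect_pure, sampledCount, goodEdges]
  | cons e S ih =>
    cases t with
    | zero => simp [sampledCount, goodEdges, expect_const]
    | succ t =>
      rw [seededLaw, expect_bind]
      have h1 : ∀ g, expect ((seededLaw ρ S).map fun Z => (e, g) :: Z)
          (fun Z => x ^ sampledCount b sel (Z.take (t + 1))) =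
          (if sel g ∧ meetCount e (S.take t) ≤ b then x else 1) *
            expect (seededLaw ρ S) (fun Z => x ^ sampledCount b sel (Z.take t)) := by
        intro g
        rw [expect_map, ← expect_const_mul]
        refine expect_congr fun Z hZ => ?_
        rw [List.take_succ_cons, sampledCount, List.map_take, map_fst_of_mem_support ρ S Z hZ,
          pow_add, mul_comm]
        split_ifs <;> simp
      simp only [h1, expect_mul_const, ih t]
      rw [List.take_succ_cons, goodEdges]
      by_cases h : meetCount e (S.take t) ≤ b
      · simp only [h, and_true, if_true, expect_ite, mul_one, List.length_cons, pow_succ]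
        rw [mul_comm]
      · simp [h, expect_const]

/-- Chernoff's bound. The sign of `y` is free, so upper and lower tails are both covered. -/
theorem sampledCount_tail_le {ρ : PMF B} {sel : B → Prop} {p : ℝ} (hp0 : 0 ≤ p) (hp1 : p ≤ 1)
    (hρ : ρ.toOuterMeasure {g | sel g} = ENNReal.ofReal p) (b : ℕ) (S : List (Sym2 V)) (t : ℕ)
    (y r : ℝ) :
    (seededLaw ρ S).toOuterMeasure {Z | r ≤ y * sampledCount b sel (Z.take t)} ≤
      ENNReal.ofReal (Real.exp
        (p * (goodEdges b (S.take t)).length * (Real.exp y - 1) - r)) := by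
  have hnot : ρ.toOuterMeasure {g | ¬ sel g} = ENNReal.ofReal (1 - p) := by
    have h := toOuterMeasure_add_not ρ sel
    rw [hρ] at h
    rw [ENNReal.ofReal_sub _ hp0, ENNReal.ofReal_one, ← h,
      ENNReal.add_sub_cancel_left ENNReal.ofReal_ne_top]
  have hE := expect_pow_sampledCount ρ b sel (ENNReal.ofReal (Real.exp y)) S t
  have hM := mul_toOuterMeasure_le_expect (seededLaw ρ S)
    (fun Z => ENNReal.ofReal (Real.exp y) ^ sampledCount b sel (Z.take t))
    (ENNReal.ofReal (Real.exp r))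
  rw [hE, hρ, hnot, ← ENNReal.ofReal_mul hp0,
    ← ENNReal.ofReal_add (by positivity) (by linarith)] at hM
  have hset : {Z : List (Sym2 V × B) | ENNReal.ofReal (Real.exp r) ≤
      ENNReal.ofReal (Real.exp y) ^ sampledCount b sel (Z.take t)} =
      {Z | r ≤ y * sampledCount b sel (Z.take t)} := by
    ext Z
    rw [Set.mem_ofPred_eq, Set.mem_ofPred_eq, ← ENNReal.ofReal_pow (Real.exp_pos y).le,
      ENNReal.ofReal_le_ofReal_iff (by positivity), ← Real.exp_nat_mul, Real.exp_le_exp, mul_comm]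
  rw [hset] at hM
  rw [sub_eq_add_neg, Real.exp_add, Real.exp_neg, ← div_eq_mul_inv,
    ENNReal.ofReal_div_of_pos (Real.exp_pos r)]
  rw [ENNReal.le_div_iff_mul_le (by simp [Real.exp_pos]) (by simp)]
  refine hM.trans ?_
  rw [← ENNReal.ofReal_pow (by have := Real.exp_pos y; nlinarith)]
  refine ENNReal.ofReal_le_ofReal ?_
  have h1 : p * Real.exp y + (1 - p) ≤ Real.exp (p * (Real.exp y - 1)) := by
    have := Real.add_one_le_exp (p * (Real.exp y - 1))
    linarith
  calc _ ≤ Real.exp (p * (Real.exp y - 1)) ^ (goodEdges b (S.take t)).length :=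
        pow_le_pow_left₀ (by have := Real.exp_pos y; nlinarith) h1 _
    _ = _ := by rw [← Real.exp_nat_mul]; ring_nf

end Sampling

/-! ### From seeded state machines to bounded-memory algorithms. -/

section Encoding

/-- Injectivity is needed only on the invariant set `R`, which no run leaves, so `Q` itself may be
infinite. -/
theorem exists_streamingAlgorithm {Q α B : Type} (ρ : PMF B) (step : Q → α × B → Q) (q₀ : Q)
    (out : Q → ℝ) (R : Set Q) (h₀ : q₀ ∈ R) (hstep : ∀ q ∈ R, ∀ x, step q x ∈ R) {s w : ℕ}
    (enc : Q → WordMemory s w) (henc : Set.InjOn enc R) :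
    ∃ alg : StreamingAlgorithm α s w, ∀ S : List α,
      alg.outputLaw S = (seededLaw ρ S).map fun Z => out (Z.foldl step q₀) := by
  have : Nonempty Q := ⟨q₀⟩
  let dec := Function.invFunOn enc R
  have hdec : ∀ q ∈ R, dec (enc q) = q := henc.leftInvOn_invFunOn
  let alg : StreamingAlgorithm α s w :=
    { init := PMF.pure (enc q₀)
      update := fun m a => ρ.map fun g => enc (step (dec m) (a, g))
      output := fun m => out (dec m) }
  have hfold : ∀ Z : List (α × B), ∀ q ∈ R, Z.foldl step q ∈ R := by
    intro Z
    induction Z with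
    | nil => exact fun q hq => hq
    | cons x Z ih => exact fun q hq => ih _ (hstep q hq x)
  have hrun : ∀ S : List α, ∀ q ∈ R,
      alg.runFrom (enc q) S = (seededLaw ρ S).map fun Z => enc (Z.foldl step q) := by
    intro S
    induction S with
    | nil => intro q _; simp [StreamingAlgorithm.runFrom, seededLaw, PMF.pure_map]
    | cons a S ih =>
      intro q hq
      simp only [StreamingAlgorithm.runFrom, seededLaw, PMF.map_bind, alg, PMF.bind_map]
      congr 1
      funext g
      have := ih _ (hstep q hq (a, g))
      simp only [alg] at this
      simp only [Function.comp_apply, hdec q hq, this, PMF.map_comp]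
      rfl
  refine ⟨alg, fun S => ?_⟩
  rw [StreamingAlgorithm.outputLaw]
  simp only [alg, PMF.pure_bind]
  have := hrun S q₀ h₀
  simp only [alg] at this
  rw [this, PMF.map_comp]
  congr 1
  funext Z
  simp [hdec _ (hfold Z q₀ h₀)]

end Encoding

/-! ### One sampling level. -/

section Records

variable {V B : Type}

/-- Update of a stored edge and its counter on the arrival of `a`; the edge is dropped when the
counter would exceed `b`. -/
noncomputable def bump (b : ℕ) (a : Sym2 V) (r : Sym2 V × ℕ) : Option (Sym2 V × ℕ) :=
  if Meets r.1 a then if r.2 + 1 ≤ b then some (r.1, r.2 + 1) else none else some r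

/-- Update of the stored list of edges with counters on the arrival of a seeded edge. -/
noncomputable def recordStep (b : ℕ) (sel : B → Prop) (l : List (Sym2 V × ℕ)) (x : Sym2 V × B) :
    List (Sym2 V × ℕ) :=
  l.filterMap (bump b x.1) ++ if sel x.2 then [(x.1, 0)] else []

theorem recordStep_le {b : ℕ} {sel : B → Prop} {l : List (Sym2 V × ℕ)}
    (hl : ∀ r ∈ l, r.2 ≤ b) (x : Sym2 V × B) : ∀ r ∈ recordStep b sel l x, r.2 ≤ b := by
  intro r hr
  rw [recordStep, List.mem_append, List.mem_filterMap] at hr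
  rcases hr with ⟨r', hr', h⟩ | h
  · rw [bump] at h
    split_ifs at h with h1 h2
    · simp only [Option.some.injEq] at h
      subst h
      exact h2
    · simp only [Option.some.injEq] at h
      exact h ▸ hl r' hr'
  · split_ifs at h
    · simp only [List.mem_singleton] at h
      simp [h]
    · simp at h

/-- A record survives exactly when its counter plus its future meetings stays within `b`; a fresh
record starts at `0`, so it survives iff its edge is good. -/
theorem length_foldl_recordStep_aux {b : ℕ} (sel : B → Prop) (Z : List (Sym2 V × B)) :
    ∀ l : List (Sym2 V × ℕ), (∀ r ∈ l, r.2 ≤ b) →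
      (Z.foldl (recordStep b sel) l).length =
        l.countP (fun r => r.2 + meetCount r.1 (Z.map Prod.fst) ≤ b) + sampledCount b sel Z := by
  induction Z with
  | nil =>
    intro l hl
    simp only [List.foldl_nil, List.map_nil, sampledCount, add_zero, meetCount, List.countP_nil]
    exact (List.countP_eq_length.2 fun r hr => by simpa using hl r hr).symm
  | cons x Z ih =>
    intro l hl
    rw [List.foldl_cons, ih _ (recordStep_le hl x), recordStep, List.countP_append, sampledCount]
    have h1 : (l.filterMap (bump b x.1)).countP
        (fun r => r.2 + meetCount r.1 (Z.map Prod.fst) ≤ b) =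
        l.countP (fun r => r.2 + meetCount r.1 ((x :: Z).map Prod.fst) ≤ b) := by
      rw [List.countP_filterMap]
      refine List.countP_congr fun r _ => ?_
      rw [List.map_cons, meetCount_cons, bump]
      split_ifs with h1 h2
      · simp only [Option.map_some, Option.getD_some]
        rw [add_assoc, add_comm 1]
      · simp only [Option.map_none, Option.getD_none, decide_eq_true_eq, Bool.false_eq_true,
          false_iff]
        omega
      · simp
    have h2 : (if sel x.2 then [(x.1, 0)] else []).countP
        (fun r : Sym2 V × ℕ => r.2 + meetCount r.1 (Z.map Prod.fst) ≤ b) =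
        if sel x.2 ∧ meetCount x.1 (Z.map Prod.fst) ≤ b then 1 else 0 := by
      by_cases h : sel x.2 <;> simp [h, List.countP_cons]
    rw [h1, h2]
    ring

theorem length_foldl_recordStep (b : ℕ) (sel : B → Prop) (Z : List (Sym2 V × B)) :
    (Z.foldl (recordStep b sel) []).length = sampledCount b sel Z := by
  simpa using length_foldl_recordStep_aux sel Z [] (by simp)

/-- As `recordStep`, but the list is given up once it has more than `T` entries. -/
noncomputable def levelStep (b T : ℕ) (sel : B → Prop) (o : Option (List (Sym2 V × ℕ)))
    (x : Sym2 V × B) : Option (List (Sym2 V × ℕ)) :=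
  o.bind fun l => if (recordStep b sel l x).length ≤ T then some (recordStep b sel l x) else none

theorem foldl_levelStep_eq_some {b T : ℕ} {sel : B → Prop} {Z : List (Sym2 V × B)}
    {l : List (Sym2 V × ℕ)} (h : Z.foldl (levelStep b T sel) (some []) = some l) :
    l = Z.foldl (recordStep b sel) [] := by
  induction Z using List.reverseRecOn generalizing l with
  | nil => simpa using h.symm
  | append_singleton Z x ih =>
    rw [List.foldl_concat] at h ⊢
    rw [levelStep, Option.bind_eq_some_iff] at h
    obtain ⟨l', hl', h⟩ := h
    rw [← ih hl']
    split_ifs at h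
    exact (Option.some.inj h).symm

/-- The stored count can fall again as edges arrive, so the final count alone does not show that a
level survived; every prefix has to be checked. -/
theorem foldl_levelStep_of_le {b T : ℕ} {sel : B → Prop} {Z : List (Sym2 V × B)}
    (h : ∀ Z', Z' <+: Z → sampledCount b sel Z' ≤ T) :
    Z.foldl (levelStep b T sel) (some []) = some (Z.foldl (recordStep b sel) []) := by
  induction Z using List.reverseRecOn with
  | nil => rfl
  | append_singleton Z x ih =>
    have h1 := ih fun Z' hZ' => h Z' (hZ'.trans (List.prefix_append _ _))
    have h2 := h _ (List.prefix_refl _)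
    rw [← length_foldl_recordStep, List.foldl_concat] at h2
    rw [List.foldl_concat, List.foldl_concat, h1, levelStep, Option.bind_some, if_pos h2]

end Records

/-! ### All levels together, and the size of their state space. -/

section Levels

variable {V B : Type} {L : ℕ}

/-- One step of all sampling levels. -/
noncomputable def step (b T : ℕ) (sel : ℕ → B → Prop) (σ : Fin (L + 1) → Option (List (Sym2 V × ℕ)))
    (x : Sym2 V × B) : Fin (L + 1) → Option (List (Sym2 V × ℕ)) :=
  fun i => levelStep b T (sel i) (σ i) x

theorem foldl_step_apply (b T : ℕ) (sel : ℕ → B → Prop) (Z : List (Sym2 V × B)) (i : Fin (L + 1)) :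
    ∀ σ, Z.foldl (step b T sel) σ i = Z.foldl (levelStep b T (sel i)) (σ i) := by
  induction Z with
  | nil => exact fun σ => rfl
  | cons x Z ih => exact fun σ => ih _

/-- The estimate read off the densest level that has not been given up. -/
noncomputable def estimate (σ : Fin (L + 1) → Option (List (Sym2 V × ℕ))) : ℝ :=
  if h : ∃ i : ℕ, ∃ (hi : i < L + 1) (l : List (Sym2 V × ℕ)), σ ⟨i, hi⟩ = some l then
    3 * 2 ^ Nat.find h * ((Nat.find_spec h).choose_spec.choose.length : ℝ)
  else 0

/-- Survival of level `k` only bounds the level used; which `i ≤ k` it is depends on the seeds. -/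
theorem estimate_foldl_step {b T : ℕ} {sel : ℕ → B → Prop} {Z : List (Sym2 V × B)} {k : ℕ}
    (hk : k ≤ L) (hZ : ∀ t, sampledCount b (sel k) (Z.take t) ≤ T) :
    ∃ i ≤ k, estimate (Z.foldl (step (L := L) b T sel) fun _ => some []) =
      3 * 2 ^ i * (sampledCount b (sel i) Z : ℝ) := by
  have hk' : ∃ (hi : k < L + 1) (l : List (Sym2 V × ℕ)),
      Z.foldl (step (L := L) b T sel) (fun _ => some []) ⟨k, hi⟩ = some l := by
    refine ⟨by omega, Z.foldl (recordStep b (sel k)) [], ?_⟩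
    rw [foldl_step_apply]
    refine foldl_levelStep_of_le fun Z' hZ' => ?_
    rw [List.prefix_iff_eq_take.1 hZ']
    exact hZ _
  have h : ∃ i : ℕ, ∃ (hi : i < L + 1) (l : List (Sym2 V × ℕ)),
      Z.foldl (step (L := L) b T sel) (fun _ => some []) ⟨i, hi⟩ = some l := ⟨k, hk'⟩
  refine ⟨Nat.find h, Nat.find_min' h hk', ?_⟩
  · rw [estimate, dif_pos h]
    have hs := (Nat.find_spec h).choose_spec.choose_spec
    have hs' := (foldl_step_apply b T sel Z _ _).symm.trans hs
    rw [← length_foldl_recordStep, ← foldl_levelStep_eq_some hs']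

/-- The states in which all levels hold at most `T` edges, with counters at most `b`. -/
def smallStates (V : Type) (L b T : ℕ) : Set (Fin (L + 1) → Option (List (Sym2 V × ℕ))) :=
  {σ | ∀ i l, σ i = some l → l.length ≤ T ∧ ∀ r ∈ l, r.2 ≤ b}

theorem step_mem_smallStates {b T : ℕ} {sel : ℕ → B → Prop}
    {σ : Fin (L + 1) → Option (List (Sym2 V × ℕ))} (hσ : σ ∈ smallStates V L b T)
    (x : Sym2 V × B) : step b T sel σ x ∈ smallStates V L b T := by
  intro i l h
  rw [step, levelStep, Option.bind_eq_some_iff] at h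
  obtain ⟨l', hl', h⟩ := h
  split_ifs at h with hT
  obtain rfl := Option.some.inj h
  exact ⟨hT, recordStep_le (hσ i l' hl').2 x⟩

theorem exists_injOn_smallStates [Fintype V] {b T s w : ℕ}
    (hcard : ((Fintype.card (Sym2 V) * (b + 1) + 1) ^ T + 1) ^ (L + 1) ≤ 2 ^ (s * w)) :
    ∃ enc : (Fin (L + 1) → Option (List (Sym2 V × ℕ))) → WordMemory s w,
      Set.InjOn enc (smallStates V L b T) := by
  let φ : (Fin (L + 1) → Option (List (Sym2 V × ℕ))) →
      Fin (L + 1) → Option (Fin T → Option (Sym2 V × Fin (b + 1))) :=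
    -- Positions past the end of the list read `none`, which records its length; reduction modulo `b
    -- + 1` loses nothing for counters at most `b`.
    fun σ i => (σ i).map fun l j => l[(j : ℕ)]?.map fun r => (r.1, Fin.ofNat (b + 1) r.2)
  have hφ : Set.InjOn φ (smallStates V L b T) := by
    intro σ hσ τ hτ h
    funext i
    have hi := congrFun h i
    simp only [φ] at hi
    cases hs : σ i with
    | none =>
      cases ht : τ i with
      | none => rfl
      | some l' => simp [hs, ht] at hi
    | some l =>
      cases ht : τ i with
      | none => simp [hs, ht] at hi
      | some l' =>
        have h1 := hσ i l hs
        have h2 := hτ i l' ht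
        simp only [hs, ht, Option.map_some, Option.some.injEq] at hi
        congr 1
        refine List.ext_getElem? fun j => ?_
        by_cases hj : j < T
        · have hij := congrFun hi ⟨j, hj⟩
          simp only at hij
          cases hl : l[j]? with
          | none =>
            cases hl' : l'[j]? with
            | none => rfl
            | some r' => simp [hl, hl'] at hij
          | some r =>
            cases hl' : l'[j]? with
            | none => simp [hl, hl'] at hij
            | some r' =>
              simp only [hl, hl', Option.map_some, Option.some.injEq, Prod.mk.injEq] at hij
              have a1 := h1.2 r (List.mem_of_getElem? hl)
              have a2 := h2.2 r' (List.mem_of_getElem? hl')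
              have a3 := congrArg Fin.val hij.2
              simp only [Fin.ofNat_eq_cast, Fin.val_natCast] at a3
              rw [Nat.mod_eq_of_lt (by omega), Nat.mod_eq_of_lt (by omega)] at a3
              exact congrArg some (Prod.ext hij.1 a3)
        · rw [List.getElem?_eq_none (by omega), List.getElem?_eq_none (by omega)]
  obtain ⟨ψ⟩ : Nonempty ((Fin (L + 1) → Option (Fin T → Option (Sym2 V × Fin (b + 1)))) ↪
      WordMemory s w) := by
    have hB : Fintype.card (BitVec w) = 2 ^ w := by
      rw [Fintype.card_congr (BitVec.equivFin (m := w)).toEquiv, Fintype.card_fin]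
    refine Function.Embedding.nonempty_of_card_le ?_
    simp only [WordMemory, Fintype.card_fun, Fintype.card_option, Fintype.card_prod,
      Fintype.card_fin, hB, ← pow_mul, mul_comm w s]
    exact hcard
  exact ⟨fun σ => ψ (φ σ), fun σ hσ τ hτ h => hφ hσ hτ (ψ.injective h)⟩

end Levels

/-! ### Nested selection from one uniform seed. -/

section Seeds

/-- Level `i` selects a `2⁻ⁱ` fraction of the seeds in `Fin (2 ^ L)`. -/
def selected (L i : ℕ) (g : Fin (2 ^ L)) : Prop := (g : ℕ) < 2 ^ (L - i)

theorem uniform_selected {L i : ℕ} (hi : i ≤ L) :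
    (PMF.uniformOfFintype (Fin (2 ^ L))).toOuterMeasure {g | selected L i g} =
      ENNReal.ofReal ((2 : ℝ) ^ i)⁻¹ := by
  rw [PMF.toOuterMeasure_uniformOfFintype_apply]
  have h1 : Fintype.card {g : Fin (2 ^ L) | selected L i g} = 2 ^ (L - i) := by
    have : Fintype.card {g : Fin (2 ^ L) | selected L i g} =
        (Finset.univ.filter fun g : Fin (2 ^ L) => (g : ℕ) < 2 ^ (L - i)).card :=
      Fintype.card_of_subtype _ fun g => by simp [selected]
    rw [this, Fin.card_filter_val_lt]
    exact min_eq_right (Nat.pow_le_pow_right (by norm_num) (Nat.sub_le _ _))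
  rw [h1, Fintype.card_fin, ENNReal.ofReal_inv_of_pos (by positivity),
    ENNReal.ofReal_pow (by norm_num)]
  push_cast
  rw [ENNReal.ofReal_ofNat]
  have h2 : (2 : ENNReal) ^ L = 2 ^ (L - i) * 2 ^ i := by
    rw [← pow_add, Nat.sub_add_cancel hi]
  rw [h2, div_eq_mul_inv, ENNReal.mul_inv (by simp) (by simp), ← mul_assoc,
    ENNReal.mul_inv_cancel (by simp) (by simp), one_mul]

theorem sampledCount_selected_zero {V : Type} (L b : ℕ) (Z : List (Sym2 V × Fin (2 ^ L))) :
    sampledCount b (selected L 0) Z = (goodEdges b (Z.map Prod.fst)).length := by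
  induction Z with
  | nil => rfl
  | cons x Z ih =>
    have : selected L 0 x.2 := x.2.2
    rw [sampledCount, List.map_cons, goodEdges, ih]
    simp only [this, true_and]
    split_ifs <;> simp

end Seeds

/-! ### Concentration at all relevant levels. -/

section Concentration

variable {V : Type} {L b T k : ℕ} {S : List (Sym2 V)} {q : ℝ}

/-- Level `k` never holds more than `T` edges, and the levels up to `k` estimate the number of good
edges up to a factor `3`. -/
def Accurate (L b T k : ℕ) (S : List (Sym2 V)) (Z : List (Sym2 V × Fin (2 ^ L))) : Prop :=
  (∀ t, sampledCount b (selected L k) (Z.take t) ≤ T) ∧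
    ∀ i ≤ k, ((goodEdges b S).length : ℝ) ≤ 3 * 2 ^ i * sampledCount b (selected L i) Z ∧
      3 * 2 ^ i * (sampledCount b (selected L i) Z : ℝ) ≤ 9 * (goodEdges b S).length

theorem overflow_le (hk : k ≤ L) (t : ℕ)
    (hT : 3 * (goodEdges b (S.take t)).length ≤ 2 ^ k * T) (hq : q ≤ T) :
    (seededLaw (PMF.uniformOfFintype (Fin (2 ^ L))) S).toOuterMeasure
        {Z | (T : ℝ) ≤ 1 * sampledCount b (selected L k) (Z.take t)} ≤
      ENNReal.ofReal (Real.exp (-(q / 4))) := by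
  refine (sampledCount_tail_le (by positivity)
    (inv_le_one_of_one_le₀ (one_le_pow₀ (by norm_num))) (uniform_selected hk) b S t 1 T).trans ?_
  refine ENNReal.ofReal_le_ofReal (Real.exp_le_exp.2 ?_)
  -- With mean at most `T/3` and `e - 1 ≤ 2`, the exponent is at most `2T/3 - T = -T/3`.
  have h1 : ((2 : ℝ) ^ k)⁻¹ * (goodEdges b (S.take t)).length ≤ T / 3 := by
    rw [inv_mul_le_iff₀ (by positivity)]
    have : (3 : ℝ) * (goodEdges b (S.take t)).length ≤ 2 ^ k * T := by exact_mod_cast hT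
    linarith
  have h2 : Real.exp 1 - 1 ≤ 2 := by linarith [Real.exp_one_lt_three]
  have h3 : (0 : ℝ) ≤ Real.exp 1 - 1 := by linarith [Real.add_one_le_exp (1 : ℝ)]
  have h4 : (0 : ℝ) ≤ T := by positivity
  have := mul_le_mul h1 h2 h3 (by positivity)
  linarith

theorem deviation_le {i : ℕ} (hi : i ≤ L)
    (hm : 2 ^ i * q ≤ (goodEdges b S).length) :
    (seededLaw (PMF.uniformOfFintype (Fin (2 ^ L))) S).toOuterMeasure
        {Z | ¬ (((goodEdges b S).length : ℝ) ≤
            3 * 2 ^ i * sampledCount b (selected L i) (Z.take S.length) ∧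
          3 * 2 ^ i * (sampledCount b (selected L i) (Z.take S.length) : ℝ) ≤
            9 * (goodEdges b S).length)} ≤
      ENNReal.ofReal (2 * Real.exp (-(q / 4))) := by
  set m : ℝ := ((goodEdges b S).length : ℝ) with hmdef
  have hm0 : 0 ≤ m := by positivity
  have hi0 : (0 : ℝ) < 2 ^ i := by positivity
  have hpm : q ≤ ((2 : ℝ) ^ i)⁻¹ * m := by
    rw [le_inv_mul_iff₀ hi0]
    exact hm
  have hpm0 : 0 ≤ ((2 : ℝ) ^ i)⁻¹ * m := by positivity
  have hp1 : ((2 : ℝ) ^ i)⁻¹ ≤ 1 := inv_le_one_of_one_le₀ (one_le_pow₀ (by norm_num))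
  have hlow := sampledCount_tail_le (by positivity) hp1 (uniform_selected hi) b S S.length (-1)
    (-(((2 : ℝ) ^ i)⁻¹ * m / 3))
  have hup := sampledCount_tail_le (by positivity) hp1 (uniform_selected hi) b S S.length 1
    (3 * (((2 : ℝ) ^ i)⁻¹ * m))
  rw [List.take_length, ← hmdef] at hlow hup
  have hsub : {Z : List (Sym2 V × Fin (2 ^ L)) | ¬ (m ≤
            3 * 2 ^ i * sampledCount b (selected L i) (Z.take S.length) ∧
          3 * 2 ^ i * (sampledCount b (selected L i) (Z.take S.length) : ℝ) ≤ 9 * m)} ⊆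
      {Z | -(((2 : ℝ) ^ i)⁻¹ * m / 3) ≤
          -1 * (sampledCount b (selected L i) (Z.take S.length) : ℝ)} ∪
        {Z | 3 * (((2 : ℝ) ^ i)⁻¹ * m) ≤
          1 * (sampledCount b (selected L i) (Z.take S.length) : ℝ)} := by
    intro Z hZ
    rw [Set.mem_ofPred_eq, not_and_or, not_le, not_le] at hZ
    have e : m = 2 ^ i * (((2 : ℝ) ^ i)⁻¹ * m) := by field_simp
    rcases hZ with hZ | hZ
    · left
      rw [Set.mem_ofPred_eq]
      rw [e] at hZ
      have : 3 * (sampledCount b (selected L i) (Z.take S.length) : ℝ) < ((2 : ℝ) ^ i)⁻¹ * m :=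
        lt_of_mul_lt_mul_left (by linarith) hi0.le
      linarith
    · right
      rw [Set.mem_ofPred_eq]
      rw [e] at hZ
      have : 3 * (((2 : ℝ) ^ i)⁻¹ * m) < (sampledCount b (selected L i) (Z.take S.length) : ℝ) :=
        lt_of_mul_lt_mul_left (by linarith) hi0.le
      linarith
  refine (MeasureTheory.measure_mono hsub).trans ((MeasureTheory.measure_union_le _ _).trans ?_)
  rw [two_mul, ENNReal.ofReal_add (Real.exp_pos _).le (Real.exp_pos _).le]
  refine add_le_add (hlow.trans ?_) (hup.trans ?_) <;>
    refine ENNReal.ofReal_le_ofReal (Real.exp_le_exp.2 ?_)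
  -- For mean `μ ≥ q` the lower-tail exponent is at most `-7μ/12 + μ/3 = -μ/4`.
  · have h1 : Real.exp (-1) - 1 ≤ -(7 / 12) := by
      have : Real.exp (-1) ≤ 5 / 12 := by
        rw [Real.exp_neg, inv_le_comm₀ (Real.exp_pos _) (by norm_num)]
        linarith [Real.exp_one_gt_d9]
      linarith
    have := mul_le_mul_of_nonneg_left h1 hpm0
    linarith
  · have h1 : Real.exp 1 - 1 ≤ 2 := by linarith [Real.exp_one_lt_three]
    have := mul_le_mul_of_nonneg_left h1 hpm0
    linarith

/-- Union bound over the `S.length + 1` prefixes for overflow and over levels `1, …, k` for both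
tails; the dependence between levels sharing a seed is harmless. -/
theorem toOuterMeasure_not_accurate_le (hk : k ≤ L)
    (hT : ∀ t, 3 * (goodEdges b (S.take t)).length ≤ 2 ^ k * T) (hq : q ≤ T)
    (hm : ∀ i, 1 ≤ i → i ≤ k → 2 ^ i * q ≤ (goodEdges b S).length) :
    (seededLaw (PMF.uniformOfFintype (Fin (2 ^ L))) S).toOuterMeasure
        {Z | ¬ Accurate L b T k S Z} ≤
      ENNReal.ofReal ((S.length + 1 + 2 * k) * Real.exp (-(q / 4))) := by
  set P := (seededLaw (PMF.uniformOfFintype (Fin (2 ^ L))) S).toOuterMeasure with hP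
  let X : ℕ → Set (List (Sym2 V × Fin (2 ^ L))) := fun t =>
    {Z | (T : ℝ) ≤ 1 * sampledCount b (selected L k) (Z.take t)}
  let Y : ℕ → Set (List (Sym2 V × Fin (2 ^ L))) := fun i =>
    {Z | ¬ (((goodEdges b S).length : ℝ) ≤
            3 * 2 ^ i * sampledCount b (selected L i) (Z.take S.length) ∧
          3 * 2 ^ i * (sampledCount b (selected L i) (Z.take S.length) : ℝ) ≤
            9 * (goodEdges b S).length)}
  have hsub : P {Z | ¬ Accurate L b T k S Z} ≤
      P ((⋃ t ∈ Finset.range (S.length + 1), X t) ∪ ⋃ i ∈ Finset.Icc 1 k, Y i) := by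
    refine PMF.toOuterMeasure_mono _ ?_
    rintro Z ⟨hZ, hsupp⟩
    by_contra hno
    refine hZ ?_
    have hfst := map_fst_of_mem_support _ S Z hsupp
    have hlen : Z.length = S.length := by simpa using congrArg List.length hfst
    rw [Set.mem_union, not_or] at hno
    obtain ⟨hX, hY⟩ := hno
    simp only [Set.mem_iUnion, not_exists] at hX hY
    have hX' : ∀ t ≤ S.length, sampledCount b (selected L k) (Z.take t) ≤ T := by
      intro t ht
      have h := hX t (Finset.mem_range.2 (by omega))
      simp only [X, Set.mem_ofPred_eq, not_le, one_mul, Nat.cast_lt] at h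
      exact h.le
    refine ⟨fun t => ?_, fun i hi => ?_⟩
    · rcases le_total t S.length with h | h
      · exact hX' t h
      · rw [List.take_of_length_le (by omega), ← List.take_length (l := Z), hlen]
        exact hX' _ le_rfl
    · rcases Nat.eq_zero_or_pos i with rfl | h
      -- Level `0` selects every edge, so its count is exact and needs no concentration.
      · rw [sampledCount_selected_zero, hfst]
        have : (0 : ℝ) ≤ (goodEdges b S).length := by positivity
        constructor <;> linarith
      · have h := hY i (Finset.mem_Icc.2 ⟨h, hi⟩)
        simp only [Y, Set.mem_ofPred_eq, not_not] at h
        rwa [← hlen, List.take_length] at h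
  refine hsub.trans ((MeasureTheory.measure_union_le _ _).trans ?_)
  have h1 : P (⋃ t ∈ Finset.range (S.length + 1), X t) ≤
      ENNReal.ofReal ((S.length + 1) * Real.exp (-(q / 4))) := by
    refine (MeasureTheory.measure_biUnion_finset_le _ _).trans
      ((Finset.sum_le_sum fun t _ => overflow_le hk t (hT t) hq).trans_eq ?_)
    rw [Finset.sum_const, Finset.card_range, ← ENNReal.ofReal_nsmul, nsmul_eq_mul]
    push_cast
    rfl
  have h2 : P (⋃ i ∈ Finset.Icc 1 k, Y i) ≤
      ENNReal.ofReal (2 * k * Real.exp (-(q / 4))) := by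
    refine (MeasureTheory.measure_biUnion_finset_le _ _).trans
      ((Finset.sum_le_sum fun i hi => deviation_le
        ((Finset.mem_Icc.1 hi).2.trans hk)
        (hm i (Finset.mem_Icc.1 hi).1 (Finset.mem_Icc.1 hi).2)).trans_eq ?_)
    rw [Finset.sum_const, Nat.card_Icc, ← ENNReal.ofReal_nsmul, nsmul_eq_mul]
    congr 1
    push_cast [Nat.add_sub_cancel]
    ring
  refine (add_le_add h1 h2).trans_eq ?_
  rw [← ENNReal.ofReal_add (by positivity) (by positivity)]
  congr 1
  ring

end Concentration

end MatchingStream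

end

namespace MatchingStream

/-! ### Choice of parameters. -/

section Parameters

theorem clog_two_le_four_mul_log {m : ℕ} (hm : 2 ≤ m) : (Nat.clog 2 m : ℝ) ≤ 4 * Real.log m := by
  have hlog2 := Real.log_two_gt_d9
  have h1 : Real.log 2 ≤ Real.log m := Real.log_le_log (by norm_num) (by exact_mod_cast hm)
  have h2 : 2 ^ (Nat.clog 2 m - 1) < m := Nat.pow_pred_clog_lt_self (by norm_num) (by omega)
  have hpos : 0 < Nat.clog 2 m := Nat.clog_pos (by norm_num) hm
  obtain ⟨j, hj⟩ := Nat.exists_eq_succ_of_ne_zero hpos.ne'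
  rw [hj, Nat.succ_sub_one] at h2
  rw [hj]
  have h3 : (j : ℝ) * Real.log 2 ≤ Real.log m := by
    rw [← Real.log_pow]
    exact Real.log_le_log (by positivity) (by exact_mod_cast h2.le)
  push_cast
  have : (0 : ℝ) ≤ j := by positivity
  nlinarith

theorem card_sym2_fin_le (n : ℕ) : Fintype.card (Sym2 (Fin n)) ≤ n ^ 2 := by
  have := Fintype.card_le_of_surjective (fun p : Fin n × Fin n => s(p.1, p.2))
    (fun e => by induction e with | _ u v => exact ⟨(u, v), rfl⟩)
  simpa [sq] using this

theorem card_states_le {n c : ℕ} (hn : 2 ≤ n) (hc : 1 ≤ c) {T L : ℕ} (hT : 0 < T) :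
    ((Fintype.card (Sym2 (Fin n)) * (2 * c + 1) + 1) ^ T + 1) ^ (L + 1) ≤
      2 ^ (5 * T * Nat.clog 2 (c * n) * (L + 1)) := by
  rw [pow_mul]
  refine Nat.pow_le_pow_left ?_ _
  have h1 : Fintype.card (Sym2 (Fin n)) * (2 * c + 1) + 1 + 1 ≤
      2 ^ (5 * Nat.clog 2 (c * n)) := by
    have h2 : c * n ≤ 2 ^ Nat.clog 2 (c * n) := Nat.le_pow_clog (by norm_num) _
    calc _ ≤ n ^ 2 * (3 * c) + 2 := by
          have := Nat.mul_le_mul (card_sym2_fin_le n) (show 2 * c + 1 ≤ 3 * c by omega)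
          omega
      _ ≤ n ^ 2 * c * n ^ 3 := by
          have a1 : 2 ^ 3 ≤ n ^ 3 := Nat.pow_le_pow_left hn 3
          have a2 : 1 ≤ n ^ 2 * c := Nat.mul_pos (by positivity) hc
          have := Nat.mul_le_mul_left (n ^ 2 * c) a1
          nlinarith
      _ = c * n ^ 5 := by ring
      _ ≤ c ^ 5 * n ^ 5 := Nat.mul_le_mul_right _ (Nat.le_self_pow (by norm_num) c)
      _ = (c * n) ^ 5 := by ring
      _ ≤ (2 ^ Nat.clog 2 (c * n)) ^ 5 := Nat.pow_le_pow_left h2 5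
      _ = _ := by rw [← pow_mul, mul_comm]
  calc _ ≤ (Fintype.card (Sym2 (Fin n)) * (2 * c + 1) + 1 + 1) ^ T := by
        simpa using pow_add_pow_le (Nat.zero_le
          (Fintype.card (Sym2 (Fin n)) * (2 * c + 1) + 1)) (Nat.zero_le 1) hT.ne'
    _ ≤ (2 ^ (5 * Nat.clog 2 (c * n))) ^ T := Nat.pow_le_pow_left h1 T
    _ = _ := by rw [← pow_mul]; ring_nf

/-- With `l = Nat.clog 2 n`, the prefactor is at most `exp (5l)` and the exponential is `exp (-(⌈A⌉₊
+ 5) l)`, so the product is at most `exp (-⌈A⌉₊ l) ≤ n ^ (-A)`. -/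
theorem failure_le {A δ : ℝ} (hA : 0 < A) {n : ℕ} (hn : 2 ≤ n) (hδ : (n : ℝ) ^ (-A) ≤ δ)
    {e k : ℕ} (he : e ≤ n ^ 2) (hk : k ≤ 2 * Nat.clog 2 n) :
    ((e : ℝ) + 1 + 2 * k) *
      Real.exp (-((((4 * ⌈A⌉₊ + 20) * Nat.clog 2 n : ℕ) : ℝ) / 4)) ≤ δ := by
  refine le_trans ?_ hδ
  set l := Nat.clog 2 n with hl
  have hn0 : (0 : ℝ) < n := by positivity
  have hpos : 1 ≤ l := Nat.clog_pos (by norm_num) hn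
  have hl1 : (1 : ℝ) ≤ l := by exact_mod_cast hpos
  have hnl : (n : ℝ) ≤ Real.exp l := by
    have h1 : (n : ℝ) ≤ 2 ^ l := by exact_mod_cast Nat.le_pow_clog (by norm_num) n
    refine h1.trans ?_
    rw [← mul_one (l : ℝ), Real.exp_nat_mul]
    exact pow_le_pow_left₀ (by norm_num) (by linarith [Real.exp_one_gt_d9]) _
  have hlog : Real.log n ≤ l := by
    rw [← Real.log_exp l]
    exact Real.log_le_log hn0 hnl
  have h1 : (e : ℝ) ≤ Real.exp (4 * l) := by
    have h2 : (e : ℝ) ≤ n ^ 2 := by exact_mod_cast he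
    refine h2.trans ((pow_le_pow_left₀ hn0.le hnl 2).trans ?_)
    rw [← Real.exp_nat_mul]
    exact Real.exp_le_exp.2 (by push_cast; linarith)
  have h2 : (1 : ℝ) + 2 * k ≤ Real.exp (4 * l) := by
    have h3 : (k : ℝ) ≤ 2 * l := by exact_mod_cast hk
    linarith [Real.add_one_le_exp (4 * (l : ℝ))]
  have h3 : (e : ℝ) + 1 + 2 * k ≤ Real.exp (5 * l) := by
    have h4 : (2 : ℝ) ≤ Real.exp l := by linarith [Real.add_one_le_exp (l : ℝ)]
    have h5 : Real.exp (5 * l) = Real.exp l * Real.exp (4 * l) := by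
      rw [← Real.exp_add]; ring_nf
    have := mul_le_mul_of_nonneg_right h4 (Real.exp_pos (4 * (l : ℝ))).le
    linarith
  refine (mul_le_mul_of_nonneg_right h3 (Real.exp_pos _).le).trans ?_
  rw [← Real.exp_add, Real.rpow_def_of_pos hn0]
  refine Real.exp_le_exp.2 ?_
  have h4 := Nat.le_ceil A
  have h5 : Real.log n * A ≤ l * ⌈A⌉₊ := mul_le_mul hlog h4 hA.le (by positivity)
  push_cast
  linarith

/-- The level at which the expected number of sampled edges is of the order of the threshold. -/
theorem exists_level {a c l M m : ℕ} (ha : 1 ≤ a) (hc : 1 ≤ c) (hl : 1 ≤ l)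
    (hMm : M ≤ m) (hM : M ≤ 2 ^ (2 * l)) :
    ∃ k ≤ 2 * l, 3 * ((2 * c + 1) * M) ≤ 2 ^ k * (18 * c * a * l) ∧
      ∀ i, 1 ≤ i → i ≤ k → 2 ^ i * (a * l) ≤ m := by
  have hal : 1 ≤ a * l := Nat.mul_pos ha hl
  have hcM : 3 * ((2 * c + 1) * M) ≤ 9 * c * M := by
    have := Nat.mul_le_mul_right M (show 3 * (2 * c + 1) ≤ 9 * c by omega)
    linarith
  have h2l : 3 * ((2 * c + 1) * M) ≤ 2 ^ (2 * l) * (18 * c * a * l) := by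
    refine hcM.trans ?_
    calc 9 * c * M ≤ 9 * c * (2 ^ (2 * l) * (2 * (a * l))) :=
          Nat.mul_le_mul_left _ (hM.trans (Nat.le_mul_of_pos_right _ (by omega)))
      _ = _ := by ring
  have h : ∃ k, 3 * ((2 * c + 1) * M) ≤ 2 ^ k * (18 * c * a * l) := ⟨2 * l, h2l⟩
  classical
  refine ⟨Nat.find h, Nat.find_min' h h2l, Nat.find_spec h, fun i h1 hi => ?_⟩
  · obtain ⟨j, rfl⟩ : ∃ j, i = j + 1 := ⟨i - 1, by omega⟩
    -- Minimality of the chosen level at `j = i - 1` gives `2 ^ j * 18cal < 9cM`; the `18` is twice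
    -- the `9`, so that `2 ^ i * al ≤ M`.
    have h2 := Nat.find_min h (m := j) (Nat.lt_of_succ_le hi)
    rw [not_le] at h2
    refine le_trans ?_ hMm
    refine Nat.le_of_mul_le_mul_left ?_ (show 0 < 9 * c by omega)
    calc 9 * c * (2 ^ (j + 1) * (a * l)) = 2 ^ j * (18 * c * a * l) := by ring
      _ ≤ _ := h2.le.trans hcM

end Parameters

/-! ### Assembly of the algorithm and the space bound. -/

theorem exists_alg {A ε δ : ℝ} (hA : 0 < A) (hε : 0 < ε) {n c : ℕ} (hn : 2 ≤ n) (hc : 1 ≤ c)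
    (hδ : (n : ℝ) ^ (-A) ≤ δ) :
    ∃ alg : StreamingAlgorithm (Sym2 (Fin n))
        (5 * (18 * c * (4 * ⌈A⌉₊ + 20) * Nat.clog 2 n) * Nat.clog 2 (c * n))
        (2 * Nat.clog 2 n + 1),
      ∀ G : SimpleGraph (Fin n), G.HasArboricityAtMost c →
      ∀ S : List (Sym2 (Fin n)), G.IsEdgeStream S →
        ENNReal.ofReal (1 - δ) ≤
          (alg.outputLaw S).toOuterMeasure
            {x | IsApproximation ((22.5 * (c : ℝ) + 6) * (1 + ε)) (G.maxMatchingSize : ℝ) x} := by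
  set a := 4 * ⌈A⌉₊ + 20 with ha
  set l := Nat.clog 2 n with hldef
  have hl : 1 ≤ l := Nat.clog_pos (by norm_num) hn
  set T := 18 * c * a * l with hT
  have hal : 1 ≤ a * l := Nat.mul_pos (by omega) hl
  have hTal : a * l ≤ T := by
    rw [hT, mul_assoc]
    exact Nat.le_mul_of_pos_left _ (by omega)
  obtain ⟨enc, henc⟩ := exists_injOn_smallStates (V := Fin n) (b := 2 * c) (T := T) (L := 2 * l)
    (card_states_le hn hc (by omega))
  obtain ⟨alg, halg⟩ := exists_streamingAlgorithm (PMF.uniformOfFintype (Fin (2 ^ (2 * l))))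
    (step (2 * c) T (selected (2 * l))) (fun _ => some []) estimate _
    (fun i l h => by
      obtain rfl := Option.some.inj h
      simp) (fun q hq x => step_mem_smallStates hq x) enc henc
  refine ⟨alg, fun G hG S hS => ?_⟩
  set M := G.maxMatchingSize with hM
  have hlow := maxMatchingSize_le_goodEdges hG hS
  -- A prefix is a stream of a subgraph, so edges good relative to the prefix are also bounded
  -- through `M`.
  have hup : ∀ t, (goodEdges (2 * c) (S.take t)).length ≤ (2 * c + 1) * M := fun t =>
    goodEdges_length_le (fun e he => (hS.2 e).1 (List.mem_of_mem_take he))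
      (hS.1.sublist (List.take_sublist _ _)) _
  have hlen : S.length ≤ n ^ 2 := (hS.1.length_le_card).trans (card_sym2_fin_le n)
  have hML : M ≤ 2 ^ (2 * l) := by
    refine (hlow.trans (goodEdges_sublist _ _).length_le).trans (hlen.trans ?_)
    rw [mul_comm, pow_mul]
    exact Nat.pow_le_pow_left (Nat.le_pow_clog (by norm_num) n) 2
  obtain ⟨k, hkL, hk, hm⟩ := exists_level (a := a) (by omega) hc hl hlow hML
  have hbad := toOuterMeasure_not_accurate_le (L := 2 * l) (b := 2 * c) (T := T) (k := k) (S := S)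
    (q := ((a * l : ℕ) : ℝ)) hkL (fun t => (Nat.mul_le_mul_left 3 (hup t)).trans hk)
    (by exact_mod_cast hTal) (fun i h1 hi => by exact_mod_cast hm i h1 hi)
  have hbad' := hbad.trans (ENNReal.ofReal_le_ofReal (failure_le hA hn hδ hlen hkL))
  have hadd := toOuterMeasure_add_not (seededLaw (PMF.uniformOfFintype (Fin (2 ^ (2 * l)))) S)
    (Accurate (2 * l) (2 * c) T k S)
  rw [halg S, PMF.toOuterMeasure_map_apply]
  have hgood : {Z | Accurate (2 * l) (2 * c) T k S Z} ⊆
      (fun Z => estimate (Z.foldl (step (L := 2 * l) (2 * c) T (selected (2 * l)))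
        fun _ => some [])) ⁻¹'
        {x | IsApproximation ((22.5 * (c : ℝ) + 6) * (1 + ε)) (M : ℝ) x} := by
    rintro Z ⟨hZ, hacc⟩
    obtain ⟨i, hi, hest⟩ := estimate_foldl_step hkL hZ
    obtain ⟨h1, h2⟩ := hacc i hi
    rw [Set.mem_preimage, Set.mem_ofPred_eq, hest]
    have h3 : (M : ℝ) ≤ (goodEdges (2 * c) S).length := by exact_mod_cast hlow
    have h4 : ((goodEdges (2 * c) S).length : ℝ) ≤ (2 * c + 1) * M := by
      have := hup S.length
      rw [List.take_length] at this
      exact_mod_cast this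
    refine ⟨h3.trans h1, h2.trans ?_⟩
    have hc' : (1 : ℝ) ≤ c := by exact_mod_cast hc
    have hM0 : (0 : ℝ) ≤ M := by positivity
    -- `18c + 9 ≤ 22.5c + 6` holds because `c ≥ 1`.
    calc 9 * ((goodEdges (2 * c) S).length : ℝ) ≤ 9 * ((2 * c + 1) * M) := by linarith
      _ = (9 * (2 * c + 1)) * M := by ring
      _ ≤ _ := by
        refine mul_le_mul_of_nonneg_right ?_ hM0
        nlinarith
  refine le_trans ?_ (MeasureTheory.measure_mono hgood)
  rw [ENNReal.ofReal_sub _ (le_trans (by positivity) hδ), ENNReal.ofReal_one, ← hadd]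
  refine tsub_le_iff_right.2 ?_
  gcongr

end MatchingStream

theorem mainTheorem1 :
    ∀ A : ℝ, 0 < A → ∃ K : ℝ, 0 < K ∧
      ∀ n c : ℕ, 2 ≤ n → 1 ≤ c →
      ∀ ε δ : ℝ, 0 < ε → ε < 1 → (n : ℝ) ^ (-A) ≤ δ → δ < 1 →
        ∃ s w : ℕ,
          (s : ℝ) ≤ K * ((c : ℝ) / ε ^ 2 * Real.log (2 / ε) * Real.log ((c : ℝ) * n) *
            Real.log n) ∧
          (w : ℝ) ≤ K * Real.log n ∧
          ∃ alg : StreamingAlgorithm (Sym2 (Fin n)) s w,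
            ∀ G : SimpleGraph (Fin n), G.HasArboricityAtMost c →
            ∀ S : List (Sym2 (Fin n)), G.IsEdgeStream S →
              ENNReal.ofReal (1 - δ) ≤
                (alg.outputLaw S).toOuterMeasure
                  {x | IsApproximation ((22.5 * (c : ℝ) + 6) * (1 + ε))
                    (G.maxMatchingSize : ℝ) x} := by
  intro A hA
  set a := 4 * ⌈A⌉₊ + 20 with ha
  have ha20 : (20 : ℝ) ≤ a := by exact_mod_cast (show 20 ≤ a by omega)
  -- `2880 = 90 · 4 · 4 · 2`: `90 = 5 · 18`, a `4` for each `Nat.clog`, and a `2` from `log (2/ε) ≥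
  -- 1/2`.
  refine ⟨2880 * a, by positivity, fun n c hn hc ε δ hε hε1 hδ _ => ?_⟩
  refine ⟨_, _, ?_, ?_, MatchingStream.exists_alg hA hε hn hc hδ⟩
  · have hcn : 2 ≤ c * n := by nlinarith
    have h1 := MatchingStream.clog_two_le_four_mul_log hn
    have h2 := MatchingStream.clog_two_le_four_mul_log hcn
    rw [Nat.cast_mul c n] at h2
    have hlogn : 0 ≤ Real.log n := Real.log_natCast_nonneg n
    have hlogcn : 0 ≤ Real.log ((c : ℝ) * n) := by
      rw [← Nat.cast_mul]
      exact Real.log_natCast_nonneg _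
    have h3 : (c : ℝ) ≤ c / ε ^ 2 :=
      le_div_self (by positivity) (by positivity) (pow_le_one₀ hε.le hε1.le)
    have h4 : 1 / 2 ≤ Real.log (2 / ε) := by
      have h5 : Real.log 2 ≤ Real.log (2 / ε) :=
        Real.log_le_log (by norm_num) (le_div_self (by norm_num) hε hε1.le)
      linarith [Real.log_two_gt_d9]
    calc ((5 * (18 * c * a * Nat.clog 2 n) * Nat.clog 2 (c * n) : ℕ) : ℝ)
        = 90 * a * c * ((Nat.clog 2 n : ℝ) * Nat.clog 2 (c * n)) := by push_cast; ring
      _ ≤ 90 * a * c * ((4 * Real.log n) * (4 * Real.log ((c : ℝ) * n))) := by gcongr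
      _ = 2880 * a * (c * (1 / 2) * Real.log ((c : ℝ) * n) * Real.log n) := by ring
      _ ≤ _ := by gcongr
  · have h1 := MatchingStream.clog_two_le_four_mul_log hn
    have h2 : (1 : ℝ) ≤ Nat.clog 2 n := by
      exact_mod_cast Nat.clog_pos (by norm_num) hn
    have hlogn : 0 ≤ Real.log n := Real.log_natCast_nonneg n
    push_cast
    nlinarith
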